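/- Let $k\ge 2$. For integers $n\ge k$, $d,q,m\ge 0$ with $q<d^k$, a random (unforced) instance consists of $m$ independent constraints on $n$ variables with domain $\{1,\dots,d\}$; each constraint is formed by a uniformly random set of $k$ distinct variables and a uniformly random set of $q$ distinct unallowed tuples among the $d^k$ tuples of values of these variables. A total assignment $t$ is a solution if for no constraint is its restriction to the constraint's variables an unallowed tuple. Let $N$ be the number of solutions, let $E$ be the expectation for unforced instances, and let $\Pr[\langle t,u\rangle]$ be the probability that both $t$ and $u$ are solutions of a random unforced instance. An instance forced to satisfy an assignment $t$ is generated in the same way, except that every constraint that $t$ violates is rejected (so its $m$ constraints are independent, each with the law of a random constraint conditioned on being satisfied by $t$); $E_{f,t}[N]$ is the expected number of solutions of such an instance, and $E_f[N]$ is the expected number when $t$ is itself first drawn uniformly from the $d^n$ assignments. (1) For all such $n,d,q,m$ we have $E[N]>0$, and for every assignment $t$, $\Pr[\langle t,t\rangle]>0$ and $$E_{f,t}[N]=\sum_{u}\frac{\Pr[\langle t,u\rangle]}{\Pr[\langle t,t\rangle]}=\frac{E[N^2]}{E[N]},$$ where $u$ runs over all $d^n$ assignments. In particular $E_{f,t}[N]$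 does not depend on $t$, and $E_f[N]=E[N^2]/E[N]$. (2) (Model RB below the threshold.) Let $\alpha>1/k$, $r>0$ and $0<p<1$ be constants such that either $r<r_{cr}:=-\alpha/\ln(1-p)$ and $p\le\frac{k-1}{k}$, or $p<p_{cr}:=1-e^{-\alpha/r}$ and $p_{cr}\le\frac{k-1}{k}$. For each $n$ let $d=d_n$, $m=m_n$, $q=q_n$ be any integer roundings of the domain size $n^\alpha$, of the number of constraints $rn\ln n$ and of the number of unallowed tuples $p\,d_n^k$, i.e. non-negative integers with $|d_n-n^\alpha|<1$, $|m_n-rn\ln n|<1$ (where $0\ln 0=0$) and $|q_n-p\,d_n^k|<1$. Then, as $n\to\infty$, $$\frac{E[N^2]}{E[N]^2}\to 1,\qquad E_f[N]\sim E[N],\qquad E_{f,t_n}[N]\sim E[N]$$ for every sequence $(t_n)$ of assignments $t_n$ of the $n$ variables. -/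

import Mathlib

open MeasureTheory ProbabilityTheory Filter
open scoped Topology Asymptotics

namespace ModelRB

/-- A total assignment of values in a domain of size `d` to `n` variables. -/
abbrev Assignment (n d : ℕ) : Type := Fin n → Fin d

/-- A constraint of arity `k` over `n` variables with domain size `d`: a set of `k` distinct
variables together with a set of `q` distinct unallowed tuples of values for these variables. -/
@[ext]
structure Constraint (n d k q : ℕ) where
  scope : Finset (Fin n)
  card_scope : scope.card = k
  unallowed : Finset (scope → Fin d)
  card_unallowed : unallowed.card = q

namespace Constraint

variable {n d k q : ℕ}

/-- The assignment `t` satisfies `c`: its restriction to the scope is not an unallowed tuple. -/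
def Satisfies (c : Constraint n d k q) (t : Assignment n d) : Prop :=
  (fun x : c.scope => t x) ∉ c.unallowed

/-- A constraint is a `k`-set of variables with a `q`-set of tuples over it. -/
def equivSigma (n d k q : ℕ) : Constraint n d k q ≃
    (Σ s : {s : Finset (Fin n) // s.card = k}, {R : Finset (s.1 → Fin d) // R.card = q}) where
  toFun c := ⟨⟨c.scope, c.card_scope⟩, ⟨c.unallowed, c.card_unallowed⟩⟩
  invFun x := ⟨x.1.1, x.1.2, x.2.1, x.2.2⟩
  left_inv _ := rfl
  right_inv _ := rfl

instance : Fintype (Constraint n d k q) := Fintype.ofEquiv _ (equivSigma n d k q).symm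

instance : MeasurableSpace (Constraint n d k q) := ⊤

instance : DiscreteMeasurableSpace (Constraint n d k q) := ⟨fun _ => trivial⟩

end Constraint

/-- An instance: a list of `m` constraints, repetitions being allowed. -/
abbrev Instance (n d k q m : ℕ) : Type := Fin m → Constraint n d k q

variable {n d k q m : ℕ}

/-- `t` is a solution of `P`: it satisfies every constraint. -/
def IsSolution (P : Instance n d k q m) (t : Assignment n d) : Prop :=
  ∀ i, (P i).Satisfies t

open Classical in
/-- The number `N` of solutions of an instance. -/
noncomputable def numSolutions (P : Instance n d k q m) : ℕ :=
  (Finset.univ.filter fun t : Assignment n d => IsSolution P t).card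

/-- The law of one random constraint: uniform among all constraints. Every set of `k` variables
carries the same number of relations, so the scope is a uniform `k`-set of variables and the
unallowed tuples form a uniform `q`-set of tuples. -/
noncomputable def constraintLaw (n d k q : ℕ) : Measure (Constraint n d k q) :=
  uniformOn Set.univ

/-- The law of an (unforced) random instance: `m` independent random constraints. -/
noncomputable def law (n d k q m : ℕ) : Measure (Instance n d k q m) :=
  Measure.pi fun _ => constraintLaw n d k q

/-- The law of a random constraint when constraints that `t` violates are rejected. -/
noncomputable def forcedConstraintLaw (k q : ℕ) (t : Assignment n d) :
    Measure (Constraint n d k q) :=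
  (constraintLaw n d k q)[|{c | c.Satisfies t}]

/-- The law of a random instance forced to satisfy `t`. -/
noncomputable def forcedLaw (k q m : ℕ) (t : Assignment n d) : Measure (Instance n d k q m) :=
  Measure.pi fun _ => forcedConstraintLaw k q t

/-- The law of a random forced instance: first draw a uniform assignment `t`, then an instance
forced to satisfy `t`. -/
noncomputable def randomForcedLaw (n d k q m : ℕ) : Measure (Instance n d k q m) :=
  (uniformOn (Set.univ : Set (Assignment n d))).bind fun t => forcedLaw k q m t

/-- `E[N]` for unforced instances. -/
noncomputable def firstMoment (n d k q m : ℕ) : ℝ :=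
  ∫ P, (numSolutions P : ℝ) ∂(law n d k q m)

/-- `E[N²]` for unforced instances. -/
noncomputable def secondMoment (n d k q m : ℕ) : ℝ :=
  ∫ P, (numSolutions P : ℝ) ^ 2 ∂(law n d k q m)

/-- `E_f[N]` for instances forced to satisfy `t`. -/
noncomputable def forcedMean (k q m : ℕ) (t : Assignment n d) : ℝ :=
  ∫ P, (numSolutions P : ℝ) ∂(forcedLaw k q m t)

/-- `E_f[N]` for instances forced to satisfy a uniformly random assignment. -/
noncomputable def randomForcedMean (n d k q m : ℕ) : ℝ :=
  ∫ P, (numSolutions P : ℝ) ∂(randomForcedLaw n d k q m)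

/-- `Pr[<t,u>]`: the probability that both `t` and `u` satisfy a random unforced instance. -/
noncomputable def pairProb (k q m : ℕ) (t u : Assignment n d) : ℝ :=
  (law n d k q m).real {P | IsSolution P t ∧ IsSolution P u}

/-- The critical value of `r`. -/
noncomputable def rCr (α p : ℝ) : ℝ := -α / Real.log (1 - p)

/-- The critical value of `p`. -/
noncomputable def pCr (α r : ℝ) : ℝ := 1 - Real.exp (-α / r)

end ModelRB

/-! Exact identity. Constraints are independent, and forcing `t` conditions each of them separately,
so a forced instance has `u` as a solution with probability Pr[⟨t,u⟩] / Pr[⟨t,t⟩]. The pair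
probability depends only on the number S of variables where `t` and `u` agree (`pairProb_eq`), so
its sum over `u` is a number `pairSum` free of `t`. Both E[N²]/E[N] and the forced means equal
`pairSum` divided by the probability that one fixed assignment is a solution.

Asymptotics. It remains to show E[N²]/E[N]² → 1; the ratio is at least 1 because the variance is
nonnegative. For the upper bound let s = S/n. By `satProb_le` the ratio is at most the mean of (1 +
c s^k)^m for S binomial(n, 1/d), where c is the odds q/(d^k - q). Replacing c by p/(1-p) costs a
factor tending to 1, since αk > 1 gives m/d^k → 0. The mean is then cut at σ = n^(-β) with 1/k < β <
α, and at τ = n^(-ε) with ε small. For s ≤ σ the factor is at most exp(m c σ^k) → 1. For s > σ the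
binomial weight is at most (e/(s d))^S, and the factor is at most the S-th power of a rate: bounded
for s ≤ τ, and about n^(r log(1+c)) for s > τ. As log(1+c) = -log(1-p), being below the threshold
means exactly r log(1+c) < α, so d beats this rate and the terms sum to a vanishing geometric
series. The rate for s > τ rests on `log_one_add_mul_pow_le`, the place where p ≤ (k-1)/k, that is c
≤ k-1, is needed. -/

namespace ModelRB

/-! ### Counting the constraints satisfied by two assignments -/

/-- The set of variables on which two assignments agree. -/
def agreement {n d : ℕ} (t u : Assignment n d) : Finset (Fin n) :=
  Finset.univ.filter fun i => t i = u i

theorem restrict_eq_iff {n d : ℕ} (t u : Assignment n d) (s : Finset (Fin n)) :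
    ((fun x : s => t x) = fun x : s => u x) ↔ s ⊆ agreement t u := by
  simp [funext_iff, Finset.subset_iff, agreement]

theorem card_finsets_avoiding {α : Type*} [Fintype α] [DecidableEq α] (q : ℕ) (a b : α) :
    Fintype.card {R : Finset α // R.card = q ∧ a ∉ R ∧ b ∉ R} =
      (Fintype.card α - if a = b then 1 else 2).choose q := by
  have h : ∀ R : Finset α, R ∈ Finset.powersetCard q (Finset.univ \ {a, b}) ↔
      (R.card = q ∧ a ∉ R ∧ b ∉ R) := by
    intro R
    rw [Finset.mem_powersetCard, and_comm]
    refine and_congr_right fun _ => ?_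
    constructor
    · intro h
      exact ⟨fun ha => by simpa using h ha, fun hb => by simpa using h hb⟩
    · rintro ⟨ha, hb⟩ x hx
      simp only [Finset.mem_sdiff, Finset.mem_univ, Finset.mem_insert, Finset.mem_singleton,
        true_and, not_or]
      exact ⟨fun e => ha (e ▸ hx), fun e => hb (e ▸ hx)⟩
  rw [Fintype.card_of_subtype _ h, Finset.card_powersetCard,
    Finset.card_sdiff_of_subset (Finset.subset_univ _), Finset.card_univ]
  congr 2
  split_ifs with e
  · simp [e]
  · exact Finset.card_pair e

theorem card_constraint (n d k q : ℕ) :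
    Fintype.card (Constraint n d k q) = n.choose k * (d ^ k).choose q := by
  rw [Fintype.card_congr (Constraint.equivSigma n d k q), Fintype.card_sigma]
  have h : ∀ s : {s : Finset (Fin n) // s.card = k},
      Fintype.card {R : Finset (s.1 → Fin d) // R.card = q} = (d ^ k).choose q := by
    intro s
    rw [Fintype.card_finset_len]
    simp [s.2]
  simp_rw [h]
  simp

/-- The constraints satisfied by both `t` and `u`, organised by scope. -/
def satisfiedEquivSigma {n d : ℕ} (k q : ℕ) (t u : Assignment n d) :
    {c : Constraint n d k q // c.Satisfies t ∧ c.Satisfies u} ≃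
      (Σ s : {s : Finset (Fin n) // s.card = k},
        {R : Finset (s.1 → Fin d) //
          R.card = q ∧ (fun x : s.1 => t x) ∉ R ∧ (fun x : s.1 => u x) ∉ R}) where
  toFun c := ⟨⟨c.1.scope, c.1.card_scope⟩, ⟨c.1.unallowed, c.1.card_unallowed, c.2.1, c.2.2⟩⟩
  invFun x := ⟨⟨x.1.1, x.1.2, x.2.1, x.2.2.1⟩, x.2.2.2.1, x.2.2.2.2⟩
  left_inv _ := rfl
  right_inv _ := rfl

open Classical in
theorem card_satisfied {n d : ℕ} (k q : ℕ) (t u : Assignment n d) :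
    Fintype.card {c : Constraint n d k q // c.Satisfies t ∧ c.Satisfies u} =
      (agreement t u).card.choose k * (d ^ k - 1).choose q +
        (n.choose k - (agreement t u).card.choose k) * (d ^ k - 2).choose q := by
  rw [Fintype.card_congr (satisfiedEquivSigma k q t u), Fintype.card_sigma]
  -- The two restrictions to a scope coincide exactly when the scope lies in the agreement set, so
  -- one or two tuples are barred from the relation.
  have h : ∀ s : {s : Finset (Fin n) // s.card = k},
      Fintype.card {R : Finset (s.1 → Fin d) //
          R.card = q ∧ (fun x : s.1 => t x) ∉ R ∧ (fun x : s.1 => u x) ∉ R} =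
        if s.1 ⊆ agreement t u then (d ^ k - 1).choose q else (d ^ k - 2).choose q := by
    intro s
    rw [card_finsets_avoiding]
    simp only [restrict_eq_iff, Fintype.card_fun, Fintype.card_fin, Fintype.card_coe, s.2]
    split_ifs <;> rfl
  rw [Finset.sum_congr rfl fun s _ => h s]
  have h1 : ∀ f : Finset (Fin n) → ℕ, ∑ s : {s : Finset (Fin n) // s.card = k}, f s.1 =
      ∑ s ∈ Finset.powersetCard k Finset.univ, f s := by
    intro f
    refine (Finset.sum_subtype _ (fun s => ?_) f).symm
    simp [Finset.mem_powersetCard]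
  rw [h1 fun s => if s ⊆ agreement t u then (d ^ k - 1).choose q else (d ^ k - 2).choose q,
    Finset.sum_ite, Finset.sum_const, Finset.sum_const]
  have h2 : (Finset.powersetCard k Finset.univ).filter (fun s => s ⊆ agreement t u) =
      Finset.powersetCard k (agreement t u) := by
    ext s
    simp [Finset.mem_powersetCard, and_comm]
  have h3 := Finset.card_filter_add_card_filter_not (s := Finset.powersetCard k (Finset.univ : Finset (Fin n)))
    (fun s => s ⊆ agreement t u)
  rw [h2, Finset.card_powersetCard, Finset.card_powersetCard, Finset.card_univ,
    Fintype.card_fin] at h3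
  rw [h2, Finset.card_powersetCard, smul_eq_mul, smul_eq_mul]
  congr 2
  omega

/-- The probability that one random constraint is satisfied by two assignments that agree on
exactly `S` variables. -/
noncomputable def satProb (n d k q S : ℕ) : ℝ :=
  ((S.choose k * (d ^ k - 1).choose q + (n.choose k - S.choose k) * (d ^ k - 2).choose q : ℕ) : ℝ) /
    ((n.choose k * (d ^ k).choose q : ℕ) : ℝ)

theorem constraintLaw_real_satisfies {n d : ℕ} (k q : ℕ) (t u : Assignment n d) :
    (constraintLaw n d k q).real {c | c.Satisfies t ∧ c.Satisfies u} =
      satProb n d k q (agreement t u).card := by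
  classical
  rw [constraintLaw, measureReal_def, uniformOn_univ, card_constraint, satProb, ← card_satisfied,
    ENNReal.toReal_div, ENNReal.toReal_natCast, Measure.count_apply_finite _ (Set.toFinite _),
    ENNReal.toReal_natCast]
  congr 2
  rw [Fintype.card_subtype]
  congr 1
  ext c
  simp

/-! ### Moments and forced means as sums over assignments -/

theorem constraint_nonempty {n d k q : ℕ} (hn : k ≤ n) (hq : q ≤ d ^ k) :
    Nonempty (Constraint n d k q) := by
  rw [← Fintype.card_pos_iff, card_constraint]
  exact Nat.mul_pos (Nat.choose_pos hn) (Nat.choose_pos hq)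

theorem constraintLaw_isProbabilityMeasure {n d k q : ℕ} (hn : k ≤ n) (hq : q ≤ d ^ k) :
    IsProbabilityMeasure (constraintLaw n d k q) := by
  have := constraint_nonempty hn hq
  unfold constraintLaw
  infer_instance

theorem pi_real_forall {n d k q m : ℕ} (μ : Measure (Constraint n d k q)) [SigmaFinite μ]
    (A : Set (Constraint n d k q)) :
    (Measure.pi fun _ : Fin m => μ).real {P | ∀ i, P i ∈ A} = μ.real A ^ m := by
  have : {P : Instance n d k q m | ∀ i, P i ∈ A} = Set.univ.pi fun _ => A := by ext; simp
  rw [measureReal_def, this, Measure.pi_pi]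
  simp [measureReal_def]

theorem pairProb_eq {n d k q : ℕ} (hn : k ≤ n) (hq : q ≤ d ^ k) (m : ℕ) (t u : Assignment n d) :
    pairProb k q m t u = satProb n d k q (agreement t u).card ^ m := by
  have := constraintLaw_isProbabilityMeasure hn hq
  rw [← constraintLaw_real_satisfies, ← pi_real_forall, pairProb, law]
  congr 1
  ext P
  simp [IsSolution, forall_and]

open Classical in
theorem integral_numSolutions {n d k q m : ℕ} (μ : Measure (Instance n d k q m))
    [IsFiniteMeasure μ] :
    ∫ P, (numSolutions P : ℝ) ∂μ = ∑ t : Assignment n d, μ.real {P | IsSolution P t} := by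
  have h : ∀ P : Instance n d k q m, (numSolutions P : ℝ) =
      ∑ t : Assignment n d, Set.indicator {P | IsSolution P t} (fun _ => (1 : ℝ)) P := by
    intro P
    simp [numSolutions, Set.indicator_apply, Finset.sum_boole]
  simp_rw [h]
  rw [integral_finsetSum _ fun t _ => .of_finite]
  refine Finset.sum_congr rfl fun t _ => ?_
  rw [integral_indicator_const _ (MeasurableSet.of_discrete)]
  simp

open Classical in
theorem integral_numSolutions_sq {n d k q m : ℕ} (μ : Measure (Instance n d k q m))
    [IsFiniteMeasure μ] :
    ∫ P, (numSolutions P : ℝ) ^ 2 ∂μ =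
      ∑ t : Assignment n d, ∑ u : Assignment n d, μ.real {P | IsSolution P t ∧ IsSolution P u} := by
  have h : ∀ P : Instance n d k q m, (numSolutions P : ℝ) ^ 2 =
      ∑ t : Assignment n d, ∑ u : Assignment n d,
        Set.indicator {P | IsSolution P t ∧ IsSolution P u} (fun _ => (1 : ℝ)) P := by
    intro P
    have : (numSolutions P : ℝ) = ∑ t : Assignment n d, if IsSolution P t then (1 : ℝ) else 0 := by
      simp [numSolutions, Finset.sum_boole]
    rw [sq, this, Finset.sum_mul_sum]
    refine Finset.sum_congr rfl fun t _ => Finset.sum_congr rfl fun u _ => ?_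
    by_cases h1 : IsSolution P t <;> by_cases h2 : IsSolution P u <;> simp [h1, h2]
  simp_rw [h]
  rw [integral_finsetSum _ fun t _ => .of_finite]
  refine Finset.sum_congr rfl fun t _ => ?_
  rw [integral_finsetSum _ fun t _ => .of_finite]
  refine Finset.sum_congr rfl fun u _ => ?_
  rw [integral_indicator_const _ (MeasurableSet.of_discrete)]
  simp

theorem agreement_self {n d : ℕ} (t : Assignment n d) : (agreement t t).card = n := by
  simp [agreement]

theorem satProb_self_pos {n d k q : ℕ} (hn : k ≤ n) (hq : q < d ^ k) : 0 < satProb n d k q n := by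
  unfold satProb
  have h1 := Nat.choose_pos hn
  have h2 : 0 < (d ^ k - 1).choose q := Nat.choose_pos (by omega)
  have h3 := Nat.choose_pos hq.le
  positivity

/-- Off a prescribed agreement set of size S, each variable has d - 1 values left. -/
theorem sum_agreement {n d : ℕ} (t : Assignment n d) (f : ℕ → ℝ) :
    ∑ u : Assignment n d, f (agreement t u).card =
      ∑ S ∈ Finset.range (n + 1), n.choose S * ((d : ℝ) - 1) ^ (n - S) * f S := by
  classical
  have h1 : ∀ A : Finset (Fin n),
      (Finset.univ.filter fun u : Assignment n d => agreement t u = A).card =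
        (d - 1) ^ (n - A.card) := by
    intro A
    have : (Finset.univ.filter fun u : Assignment n d => agreement t u = A) =
        Fintype.piFinset fun i => if i ∈ A then {t i} else {t i}ᶜ := by
      ext u
      simp only [Finset.mem_filter, Finset.mem_univ, true_and, Fintype.mem_piFinset,
        Finset.ext_iff, agreement]
      refine forall_congr' fun i => ?_
      split_ifs with h <;> simp [h, eq_comm]
    rw [this, Fintype.card_piFinset]
    have h2 : ∀ i, (if i ∈ A then ({t i} : Finset (Fin d)) else {t i}ᶜ).card =
        if i ∈ A then 1 else d - 1 := by
      intro i
      split_ifs <;> simp [Finset.card_compl]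
    simp_rw [h2]
    rw [Finset.prod_ite]
    simp [Finset.filter_not, Finset.card_sdiff_of_subset]
  have h2 : ∑ u : Assignment n d, f (agreement t u).card =
      ∑ A : Finset (Fin n), ((d - 1) ^ (n - A.card) : ℕ) * f A.card := by
    rw [← Finset.sum_fiberwise Finset.univ (fun u => agreement t u)]
    refine Finset.sum_congr rfl fun A _ => ?_
    rw [← h1 A, ← nsmul_eq_mul, ← Finset.sum_const]
    refine Finset.sum_congr rfl fun u hu => ?_
    rw [(Finset.mem_filter.1 hu).2]
  rw [h2, ← Finset.powerset_univ,
    Finset.sum_powerset_apply_card (fun j => (((d - 1) ^ (n - j) : ℕ) : ℝ) * f j)]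
  simp only [Finset.card_univ, Fintype.card_fin, nsmul_eq_mul]
  refine Finset.sum_congr rfl fun S hS => ?_
  -- For d = 0 the truncated d - 1 differs from the real one, but the existence of `t` then forces n
  -- = 0 and the exponent vanishes.
  rcases Nat.eq_zero_or_pos d with rfl | hd
  · rcases Nat.eq_zero_or_pos n with rfl | hn
    · simp at hS
      simp [hS]
    · exact (t ⟨0, hn⟩).elim0
  · push_cast [Nat.cast_sub hd]
    ring

/-- The sum over all `u` of the probability that both `t` and `u` are solutions. -/
noncomputable def pairSum (n d k q m : ℕ) : ℝ :=
  ∑ S ∈ Finset.range (n + 1), n.choose S * ((d : ℝ) - 1) ^ (n - S) * satProb n d k q S ^ m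

theorem sum_pairProb {n d k q : ℕ} (hn : k ≤ n) (hq : q ≤ d ^ k) (m : ℕ) (t : Assignment n d) :
    ∑ u : Assignment n d, pairProb k q m t u = pairSum n d k q m := by
  simp_rw [pairProb_eq hn hq]
  exact sum_agreement t fun S => satProb n d k q S ^ m

theorem firstMoment_eq {n d k q : ℕ} (hn : k ≤ n) (hq : q ≤ d ^ k) (m : ℕ) :
    firstMoment n d k q m = (d : ℝ) ^ n * satProb n d k q n ^ m := by
  have := constraintLaw_isProbabilityMeasure hn hq
  have : IsProbabilityMeasure (law n d k q m) := by unfold law; infer_instance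
  rw [firstMoment, integral_numSolutions]
  have : ∀ t : Assignment n d, (law n d k q m).real {P | IsSolution P t} =
      satProb n d k q n ^ m := by
    intro t
    have h := pairProb_eq hn hq m t t
    rw [agreement_self] at h
    simpa [pairProb] using h
  simp [this]

theorem secondMoment_eq {n d k q : ℕ} (hn : k ≤ n) (hq : q ≤ d ^ k) (m : ℕ) :
    secondMoment n d k q m = (d : ℝ) ^ n * pairSum n d k q m := by
  have := constraintLaw_isProbabilityMeasure hn hq
  have : IsProbabilityMeasure (law n d k q m) := by unfold law; infer_instance
  rw [secondMoment, integral_numSolutions_sq]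
  have := sum_pairProb hn hq m (d := d)
  simp only [pairProb] at this
  simp [this]

theorem sq_firstMoment_le_secondMoment {n d k q : ℕ} (hn : k ≤ n) (hq : q ≤ d ^ k) (m : ℕ) :
    firstMoment n d k q m ^ 2 ≤ secondMoment n d k q m := by
  have := constraintLaw_isProbabilityMeasure hn hq
  have : IsProbabilityMeasure (law n d k q m) := by unfold law; infer_instance
  have h := variance_eq_sub (μ := law n d k q m) (X := fun P => (numSolutions P : ℝ)) .of_discrete
  have h2 := variance_nonneg (fun P => (numSolutions P : ℝ)) (law n d k q m)
  rw [h] at h2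
  simpa [firstMoment, secondMoment] using h2

theorem forcedConstraintLaw_isProbabilityMeasure {n d k q : ℕ} (hn : k ≤ n) (hq : q < d ^ k)
    (t : Assignment n d) : IsProbabilityMeasure (forcedConstraintLaw k q t) := by
  have := constraintLaw_isProbabilityMeasure hn hq.le
  refine cond_isProbabilityMeasure fun h => ?_
  have h1 := constraintLaw_real_satisfies k q t t
  rw [agreement_self] at h1
  have h2 := satProb_self_pos hn hq
  rw [← h1] at h2
  simp [measureReal_def, h] at h2

theorem forcedLaw_isProbabilityMeasure {n d k q : ℕ} (hn : k ≤ n) (hq : q < d ^ k) (m : ℕ)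
    (t : Assignment n d) : IsProbabilityMeasure (forcedLaw k q m t) := by
  have := forcedConstraintLaw_isProbabilityMeasure hn hq t
  unfold forcedLaw
  infer_instance

/-- The forced law is a product, so each term is the m-th power of a conditional probability for one
constraint. -/
theorem forcedMean_eq_sum {n d k q : ℕ} (hn : k ≤ n) (hq : q < d ^ k) (m : ℕ)
    (t : Assignment n d) :
    forcedMean k q m t = ∑ u : Assignment n d, pairProb k q m t u / pairProb k q m t t := by
  have := constraintLaw_isProbabilityMeasure hn hq.le
  have := forcedConstraintLaw_isProbabilityMeasure hn hq t
  have := forcedLaw_isProbabilityMeasure hn hq m t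
  rw [forcedMean, integral_numSolutions]
  refine Finset.sum_congr rfl fun u _ => ?_
  rw [pairProb_eq hn hq.le, pairProb_eq hn hq.le, ← div_pow, ← constraintLaw_real_satisfies,
    ← constraintLaw_real_satisfies]
  have h := pi_real_forall (m := m) (forcedConstraintLaw k q t) {c | c.Satisfies u}
  refine h.trans ?_
  congr 1
  rw [forcedConstraintLaw, measureReal_def, cond_apply MeasurableSet.of_discrete,
    ENNReal.toReal_mul, ENNReal.toReal_inv, div_eq_inv_mul]
  simp [measureReal_def, Set.ofPred_and]

theorem forcedMean_eq {n d k q : ℕ} (hn : k ≤ n) (hq : q < d ^ k) (m : ℕ) (t : Assignment n d) :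
    forcedMean k q m t = pairSum n d k q m / satProb n d k q n ^ m := by
  rw [forcedMean_eq_sum hn hq, ← Finset.sum_div, sum_pairProb hn hq.le, pairProb_eq hn hq.le,
    agreement_self]

theorem secondMoment_div_firstMoment {n d k q : ℕ} (hk : k ≠ 0) (hn : k ≤ n) (hq : q < d ^ k)
    (m : ℕ) :
    secondMoment n d k q m / firstMoment n d k q m = pairSum n d k q m / satProb n d k q n ^ m := by
  have hd : (d : ℝ) ≠ 0 := by
    rintro h
    rw [Nat.cast_eq_zero.1 h, zero_pow hk] at hq
    omega
  rw [secondMoment_eq hn hq.le, firstMoment_eq hn hq.le, mul_div_mul_left _ _ (pow_ne_zero _ hd)]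

theorem firstMoment_pos {n d k q : ℕ} (hk : k ≠ 0) (hn : k ≤ n) (hq : q < d ^ k) (m : ℕ) :
    0 < firstMoment n d k q m := by
  have hd : 0 < d := by
    rcases Nat.eq_zero_or_pos d with rfl | h
    · rw [zero_pow hk] at hq
      omega
    · exact h
  rw [firstMoment_eq hn hq.le]
  have := satProb_self_pos hn hq
  positivity

theorem integral_bind_of_finite {Ω Ω' : Type*} [Finite Ω] [MeasurableSpace Ω]
    [DiscreteMeasurableSpace Ω] [Finite Ω'] [MeasurableSpace Ω'] [DiscreteMeasurableSpace Ω']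
    (μ : Measure Ω) [IsFiniteMeasure μ] (κ : Ω → Measure Ω') [∀ x, IsProbabilityMeasure (κ x)]
    (f : Ω' → ℝ) : ∫ y, f y ∂(μ.bind κ) = ∫ x, ∫ y, f y ∂(κ x) ∂μ := by
  let K : Kernel Ω Ω' := ⟨κ, measurable_of_finite κ⟩
  have : IsMarkovKernel K := ⟨fun x => inferInstanceAs (IsProbabilityMeasure (κ x))⟩
  have h := Kernel.integral_comp (κ := Kernel.const Unit μ) (η := K) (a := ()) (f := f) .of_finite
  rwa [Kernel.comp_apply, Kernel.const_apply] at h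

theorem randomForcedMean_eq {n d k q : ℕ} (hk : k ≠ 0) (hn : k ≤ n) (hq : q < d ^ k) (m : ℕ) :
    randomForcedMean n d k q m = pairSum n d k q m / satProb n d k q n ^ m := by
  have hd : d ≠ 0 := by
    rintro rfl
    rw [zero_pow hk] at hq
    omega
  have : NeZero d := ⟨hd⟩
  have := forcedLaw_isProbabilityMeasure hn hq m
  rw [randomForcedMean, randomForcedLaw, integral_bind_of_finite]
  have h : ∀ t : Assignment n d, ∫ P, (numSolutions P : ℝ) ∂(forcedLaw k q m t) =
    pairSum n d k q m / satProb n d k q n ^ m := fun t => forcedMean_eq hn hq m t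
  simp [h]

/-! ### Bounding the moment ratio by a binomial mean -/

/-- Each factor (S - j)/(n - j) of the quotient of binomial coefficients is at most S/n. -/
theorem choose_mul_pow_le {S n : ℕ} (h : S ≤ n) (k : ℕ) :
    S.choose k * n ^ k ≤ n.choose k * S ^ k := by
  induction k with
  | zero => simp
  | succ k ih =>
    refine Nat.le_of_mul_le_mul_right (c := k + 1) ?_ k.succ_pos
    have h1 : (S - k) * n ≤ (n - k) * S := by
      rw [Nat.sub_mul, Nat.sub_mul, mul_comm S n]
      exact Nat.sub_le_sub_left (Nat.mul_le_mul_left k h) _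
    calc S.choose (k + 1) * n ^ (k + 1) * (k + 1)
        = S.choose (k + 1) * (k + 1) * n ^ (k + 1) := by ring
      _ = S.choose k * n ^ k * ((S - k) * n) := by rw [Nat.choose_succ_right_eq]; ring
      _ ≤ n.choose k * S ^ k * ((n - k) * S) := Nat.mul_le_mul ih h1
      _ = n.choose (k + 1) * (k + 1) * S ^ (k + 1) := by rw [Nat.choose_succ_right_eq]; ring
      _ = n.choose (k + 1) * S ^ (k + 1) * (k + 1) := by ring

theorem choose_pred_div_choose {D q : ℕ} (hq : q < D) :
    ((D - 1).choose q : ℝ) / D.choose q = (D - q) / D := by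
  obtain ⟨E, rfl⟩ : ∃ E, D = E + 1 := ⟨D - 1, by omega⟩
  have h := Nat.choose_mul_succ_eq E q
  have h1 : (0 : ℝ) < (E + 1).choose q := by exact_mod_cast Nat.choose_pos hq.le
  have h2 : ((E + 1 - q : ℕ) : ℝ) = (E + 1 : ℕ) - q := Nat.cast_sub hq.le
  rw [div_eq_div_iff h1.ne' (by positivity), ← h2, Nat.add_sub_cancel, mul_comm (_ - _ : ℕ).cast]
  exact_mod_cast h

theorem choose_sub_two_div_choose_le {D q : ℕ} (hD : 2 ≤ D) (hq : q < D) :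
    ((D - 2).choose q : ℝ) / D.choose q ≤ ((D - q) / D) ^ 2 := by
  have hD' : (0 : ℝ) < D := by positivity
  have hqD : (q : ℝ) < D := by exact_mod_cast hq
  -- For q = D - 1 the telescoping below would divide by zero when passing from D - 1 to D - 2, but
  -- the left side is then 0.
  rcases Nat.lt_or_ge q (D - 1) with h | h
  · have h1 := choose_pred_div_choose hq
    have h2 := choose_pred_div_choose h
    have h3 : ((D - 1).choose q : ℝ) ≠ 0 := by exact_mod_cast (Nat.choose_pos h.le).ne'
    rw [show D - 1 - 1 = D - 2 by omega, Nat.cast_sub (by omega), Nat.cast_one] at h2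
    have h4 : ((D - 2).choose q : ℝ) / D.choose q =
        ((D - 2).choose q : ℝ) / (D - 1).choose q * (((D - 1).choose q : ℝ) / D.choose q) := by
      field_simp
    rw [h4, h1, h2, sq]
    have hD1 : (1 : ℝ) < D := by exact_mod_cast (by omega : 1 < D)
    refine mul_le_mul_of_nonneg_right ?_ (div_nonneg (by linarith) hD'.le)
    rw [div_le_div_iff₀ (by linarith) hD']
    nlinarith [(Nat.cast_nonneg q : (0 : ℝ) ≤ q)]
  · rw [Nat.choose_eq_zero_of_lt (by omega)]
    simp only [Nat.cast_zero, zero_div]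
    positivity

theorem satProb_self {n d k q : ℕ} (hn : k ≤ n) (hq : q < d ^ k) :
    satProb n d k q n = (((d ^ k : ℕ) : ℝ) - q) / ((d ^ k : ℕ) : ℝ) := by
  have h : (n.choose k : ℝ) ≠ 0 := by exact_mod_cast (Nat.choose_pos hn).ne'
  rw [← choose_pred_div_choose hq, satProb]
  simp only [Nat.sub_self, zero_mul, add_zero, Nat.cast_mul]
  exact mul_div_mul_left _ _ h

/-- The pair probability exceeds that of independent events by a factor at most
`1 + q / (d ^ k - q) * (S / n) ^ k`. -/
theorem satProb_le {n d k q S : ℕ} (hk : k ≠ 0) (hd : 2 ≤ d) (hn : k ≤ n) (hq : q < d ^ k)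
    (hS : S ≤ n) :
    satProb n d k q S ≤ satProb n d k q n ^ 2 *
      (1 + (q : ℝ) / (((d ^ k : ℕ) : ℝ) - q) * ((S : ℝ) / n) ^ k) := by
  rw [satProb_self hn hq]
  have hD : 2 ≤ d ^ k := hd.trans (Nat.le_self_pow hk d)
  have hA := choose_pred_div_choose hq
  have hB := choose_sub_two_div_choose_le hD hq
  have hC : (0 : ℝ) < n.choose k := by exact_mod_cast Nat.choose_pos hn
  have hE : (0 : ℝ) < (d ^ k).choose q := by exact_mod_cast Nat.choose_pos hq.le
  have hn0 : (0 : ℝ) < n := by exact_mod_cast (by omega : 0 < n)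
  have hle : S.choose k ≤ n.choose k := Nat.choose_le_choose k hS
  have hx1 : (S.choose k : ℝ) / n.choose k ≤ 1 := by
    rw [div_le_one hC]; exact_mod_cast hle
  have hx : (S.choose k : ℝ) / n.choose k ≤ ((S : ℝ) / n) ^ k := by
    rw [div_pow, div_le_div_iff₀ hC (by positivity), mul_comm _ (n.choose k : ℝ)]
    exact_mod_cast choose_mul_pow_le hS k
  -- Condition on whether the scope lies inside the agreement set.
  have hs : satProb n d k q S = (S.choose k : ℝ) / n.choose k *
      (((d ^ k - 1).choose q : ℝ) / (d ^ k).choose q) +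
      (1 - (S.choose k : ℝ) / n.choose k) * (((d ^ k - 2).choose q : ℝ) / (d ^ k).choose q) := by
    rw [satProb]
    push_cast [Nat.cast_sub hle]
    field_simp
  rw [hs, hA]
  generalize d ^ k = D at *
  have hD0 : (0 : ℝ) < D := by exact_mod_cast (by omega : 0 < D)
  have hqD : (q : ℝ) < D := by exact_mod_cast hq
  have hDq : (0 : ℝ) < D - q := by linarith
  generalize (S.choose k : ℝ) / n.choose k = x at *
  calc x * ((D - q) / D) + (1 - x) * (((D - 2).choose q : ℝ) / D.choose q)
      ≤ x * ((D - q) / D) + (1 - x) * (((D : ℝ) - q) / D) ^ 2 := by gcongr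
    _ = (((D : ℝ) - q) / D) ^ 2 * (1 + (q : ℝ) / (D - q) * x) := by
        field_simp
        ring
    _ ≤ _ := by gcongr

/-- The weights are the binomial(n, 1/d) law of the agreement of a uniform assignment with a fixed
one. -/
theorem moment_ratio_le_sum {n d k q m : ℕ} (hk : k ≠ 0) (hd : 2 ≤ d) (hn : k ≤ n)
    (hq : q < d ^ k) :
    secondMoment n d k q m / firstMoment n d k q m ^ 2 ≤
      ∑ S ∈ Finset.range (n + 1), n.choose S * ((d : ℝ) - 1) ^ (n - S) / (d : ℝ) ^ n *
        (1 + (q : ℝ) / (((d ^ k : ℕ) : ℝ) - q) * ((S : ℝ) / n) ^ k) ^ m := by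
  have hd1 : (1 : ℝ) ≤ d := by exact_mod_cast (by omega : 1 ≤ d)
  have hw := satProb_self_pos hn hq
  have hF := firstMoment_pos hk hn hq m
  rw [div_le_iff₀ (by positivity), secondMoment_eq hn hq.le, firstMoment_eq hn hq.le, pairSum,
    Finset.sum_mul, Finset.mul_sum]
  refine Finset.sum_le_sum fun S hS => ?_
  have hS' : S ≤ n := Nat.lt_succ_iff.1 (Finset.mem_range.1 hS)
  have h := satProb_le hk hd hn hq hS'
  have h0 : 0 ≤ satProb n d k q S := by unfold satProb; positivity
  have hdn : (d : ℝ) ^ n ≠ 0 := by positivity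
  calc (d : ℝ) ^ n * (n.choose S * ((d : ℝ) - 1) ^ (n - S) * satProb n d k q S ^ m)
      ≤ (d : ℝ) ^ n * (n.choose S * ((d : ℝ) - 1) ^ (n - S) * (satProb n d k q n ^ 2 *
      (1 + (q : ℝ) / (((d ^ k : ℕ) : ℝ) - q) * ((S : ℝ) / n) ^ k)) ^ m) := by
        have : (0 : ℝ) ≤ d - 1 := by linarith
        gcongr
    _ = _ := by
        rw [mul_pow (satProb n d k q n ^ 2)]
        field_simp
        ring

/-! ### Splitting the binomial mean by the size of the overlap -/

theorem choose_div_pow_le {n S : ℕ} (hS : S ≠ 0) (d : ℝ) (hd : 0 < d) :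
    (n.choose S : ℝ) / d ^ S ≤ (Real.exp 1 / ((S : ℝ) / n * d)) ^ S := by
  have hS0 : (0 : ℝ) < S := by exact_mod_cast Nat.pos_of_ne_zero hS
  have h1 : (n.choose S : ℝ) ≤ (n : ℝ) ^ S / S.factorial := Nat.choose_le_pow_div S n
  have h2 : (S : ℝ) ^ S / S.factorial ≤ Real.exp S := Real.pow_div_factorial_le_exp _ hS0.le S
  have h3 : Real.exp S = Real.exp 1 ^ S := by rw [← Real.exp_nat_mul, mul_one]
  rw [h3] at h2
  have hf : (0 : ℝ) < S.factorial := by positivity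
  rw [div_le_iff₀ hf] at h2
  calc (n.choose S : ℝ) / d ^ S ≤ (n : ℝ) ^ S / S.factorial / d ^ S := by gcongr
    _ ≤ (n : ℝ) ^ S * Real.exp 1 ^ S / (S : ℝ) ^ S / d ^ S := by
        gcongr ?_ / _
        rw [div_le_div_iff₀ hf (by positivity), mul_assoc]
        gcongr
    _ = _ := by
        rw [div_pow, mul_pow, div_pow]
        field_simp

/-- The quotient log(1 + c x^k)/x increases on (0, 1]. With y = c x^k the sign of its derivative is
that of k y/(1 + y) - log(1 + y), and log(1 + y) ≤ y ≤ k y/(1 + y) because 1 + y ≤ k. -/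
theorem log_one_add_mul_pow_le {k : ℕ} (hk : k ≠ 0) {c s : ℝ} (hc0 : 0 ≤ c) (hc : c ≤ (k : ℝ) - 1)
    (hs0 : 0 < s) (hs : s ≤ 1) : Real.log (1 + c * s ^ k) ≤ s * Real.log (1 + c) := by
  have hder : ∀ x : ℝ, 0 < x → HasDerivAt (fun x => Real.log (1 + c * x ^ k) / x)
      ((c * (k * x ^ (k - 1)) / (1 + c * x ^ k) * x - Real.log (1 + c * x ^ k) * 1) / x ^ 2) x := by
    intro x hx
    have h1 : HasDerivAt (fun x : ℝ => 1 + c * x ^ k) (c * (k * x ^ (k - 1))) x :=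
      ((hasDerivAt_pow k x).const_mul c).const_add 1
    exact (h1.log (by positivity)).div (hasDerivAt_id x) hx.ne'
  have hmono : MonotoneOn (fun x => Real.log (1 + c * x ^ k) / x) (Set.Ioc 0 1) := by
    refine monotoneOn_of_deriv_nonneg (convex_Ioc 0 1)
      (fun x hx => (hder x hx.1).continuousAt.continuousWithinAt)
      (fun x hx => ?_) (fun x hx => ?_)
    · rw [interior_Ioc] at hx
      exact (hder x hx.1).differentiableAt.differentiableWithinAt
    · rw [interior_Ioc] at hx
      rw [(hder x hx.1).deriv]
      refine div_nonneg ?_ (sq_nonneg x)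
      have hx0 := hx.1
      have hy : 0 ≤ c * x ^ k := by positivity
      have hy1 : c * x ^ k ≤ k - 1 :=
        (mul_le_of_le_one_right hc0 (pow_le_one₀ hx0.le hx.2.le)).trans hc
      have h2 : c * (k * x ^ (k - 1)) / (1 + c * x ^ k) * x = k * (c * x ^ k) / (1 + c * x ^ k) := by
        rw [← pow_sub_one_mul hk x]
        field_simp
      have h3 : Real.log (1 + c * x ^ k) ≤ c * x ^ k := by
        have := Real.log_le_sub_one_of_pos (by positivity : 0 < 1 + c * x ^ k)
        linarith
      have h4 : c * x ^ k ≤ k * (c * x ^ k) / (1 + c * x ^ k) := by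
        rw [le_div_iff₀ (by positivity)]
        nlinarith
      rw [h2]
      linarith
  have h := hmono ⟨hs0, hs⟩ ⟨one_pos, le_rfl⟩ hs
  simp only [one_pow, mul_one, div_one] at h
  rw [div_le_iff₀ hs0] at h
  linarith

/-- A binomial average of `F` is bounded by splitting the indices into those where `F` is at most
`B` and those where the weighted term is at most `ρ ^ S`. -/
theorem binomial_sum_le {n : ℕ} {d B ρ : ℝ} (hd : 1 ≤ d) (hB : 0 ≤ B) (hρ0 : 0 ≤ ρ) (hρ : ρ < 1)
    {F : ℕ → ℝ} (hF0 : ∀ S, 0 ≤ F S)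
    (hF : ∀ S ≤ n, F S ≤ B ∨ (S ≠ 0 ∧ n.choose S / d ^ S * F S ≤ ρ ^ S)) :
    ∑ S ∈ Finset.range (n + 1), n.choose S * (d - 1) ^ (n - S) / d ^ n * F S ≤
      B + ρ / (1 - ρ) := by
  have hd0 : 0 < d := by linarith
  have hd1 : 0 ≤ d - 1 := by linarith
  -- Leaving out S = 0 makes the geometric series start at ρ, so its sum ρ/(1 - ρ) vanishes with ρ.
  have hterm : ∀ S ∈ Finset.range (n + 1),
      n.choose S * (d - 1) ^ (n - S) / d ^ n * F S ≤
        n.choose S * (d - 1) ^ (n - S) / d ^ n * B + (if S = 0 then 0 else ρ ^ S) := by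
    intro S hS
    have hS' : S ≤ n := Nat.lt_succ_iff.1 (Finset.mem_range.1 hS)
    have hw : (0 : ℝ) ≤ n.choose S * (d - 1) ^ (n - S) / d ^ n := by positivity
    rcases hF S hS' with h | ⟨h0, h⟩
    · have : (0 : ℝ) ≤ if S = 0 then 0 else ρ ^ S := by split_ifs <;> positivity
      have := mul_le_mul_of_nonneg_left h hw
      linarith
    · rw [if_neg h0]
      have h1 : n.choose S * (d - 1) ^ (n - S) / d ^ n ≤ n.choose S / d ^ S := by
        rw [div_le_div_iff₀ (by positivity) (by positivity)]
        calc n.choose S * (d - 1) ^ (n - S) * d ^ S ≤ n.choose S * d ^ (n - S) * d ^ S := by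
              gcongr
              linarith
          _ = n.choose S * d ^ n := by rw [mul_assoc, ← pow_add, Nat.sub_add_cancel hS']
      have h2 := mul_le_mul_of_nonneg_right h1 (hF0 S)
      have h3 := mul_nonneg hw hB
      linarith
  refine (Finset.sum_le_sum hterm).trans ?_
  rw [Finset.sum_add_distrib, ← Finset.sum_mul, ← Finset.sum_div]
  have hbin : ∑ S ∈ Finset.range (n + 1), (n.choose S : ℝ) * (d - 1) ^ (n - S) = d ^ n := by
    have h := add_pow (1 : ℝ) (d - 1) n
    rw [add_sub_cancel] at h
    rw [h]
    refine Finset.sum_congr rfl fun S _ => ?_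
    ring
  rw [hbin, div_self (by positivity), one_mul]
  gcongr
  rw [Finset.sum_range_succ']
  simp only [Nat.add_eq_zero_iff, one_ne_zero, and_false, if_false, if_true, add_zero]
  calc ∑ i ∈ Finset.range n, ρ ^ (i + 1) = ρ * ∑ i ∈ Finset.range n, ρ ^ i := by
        rw [Finset.mul_sum]; exact Finset.sum_congr rfl fun i _ => by ring
    _ ≤ ρ * (1 - ρ)⁻¹ := by
        gcongr
        rw [← tsum_geometric_of_lt_one hρ0 hρ]
        exact (summable_geometric_of_lt_one hρ0 hρ).sum_le_tsum _ fun i _ => by positivity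
    _ = ρ / (1 - ρ) := rfl

/-- The ratio of the large-overlap terms: `σ` and `τ` separate small, medium and large overlaps. -/
noncomputable def overlapRatio (n d k m : ℕ) (c σ τ : ℝ) : ℝ :=
  Real.exp 1 / (σ * d) * Real.exp (c * (m / n) * τ ^ (k - 1)) +
    Real.exp 1 / (τ * d) * Real.exp (Real.log (1 + c) * (m / n))

/-- Medium overlaps use 1 + x ≤ exp x, large ones `log_one_add_mul_pow_le`. `overlapRatio` adds the
two resulting rates, so it dominates each. -/
theorem overlap_term_le {n d k m S : ℕ} (hk : k ≠ 0) (hd : 1 ≤ d) {c σ τ : ℝ} (hc0 : 0 ≤ c)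
    (hc : c ≤ (k : ℝ) - 1) (hσ : 0 < σ) (hτ : 0 < τ) (hS : S ≤ n) :
    (1 + c * ((S : ℝ) / n) ^ k) ^ m ≤ Real.exp (m * c * σ ^ k) ∨
      (S ≠ 0 ∧ n.choose S / (d : ℝ) ^ S * (1 + c * ((S : ℝ) / n) ^ k) ^ m ≤
        overlapRatio n d k m c σ τ ^ S) := by
  have hs0 : 0 ≤ (S : ℝ) / n := by positivity
  have hd0 : (0 : ℝ) < d := by exact_mod_cast hd
  have hexp : (1 + c * ((S : ℝ) / n) ^ k) ^ m ≤ Real.exp (m * (c * ((S : ℝ) / n) ^ k)) := by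
    rw [Real.exp_nat_mul]
    have := Real.add_one_le_exp (c * ((S : ℝ) / n) ^ k)
    gcongr
    linarith
  rcases le_or_gt ((S : ℝ) / n) σ with h | h
  · left
    refine hexp.trans (Real.exp_le_exp.2 ?_)
    rw [mul_assoc]
    gcongr
  · right
    have hS0 : S ≠ 0 := by
      rintro rfl
      simp at h
      linarith
    have hn0 : (0 : ℝ) < n := by exact_mod_cast (by omega : 0 < n)
    have hsS : (S : ℝ) / n ≤ 1 := by
      rw [div_le_one hn0]; exact_mod_cast hS
    have hspos : 0 < (S : ℝ) / n := hσ.trans h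
    refine ⟨hS0, ?_⟩
    have hch := choose_div_pow_le (n := n) hS0 (d : ℝ) hd0
    unfold overlapRatio
    rcases le_or_gt ((S : ℝ) / n) τ with h1 | h1
    · have hF : (1 + c * ((S : ℝ) / n) ^ k) ^ m ≤ Real.exp (c * (m / n) * τ ^ (k - 1)) ^ S := by
        refine hexp.trans ?_
        rw [← Real.exp_nat_mul, ← pow_sub_one_mul hk]
        refine Real.exp_le_exp.2 ?_
        calc m * (c * (((S : ℝ) / n) ^ (k - 1) * (S / n)))
            = S * (c * (m / n) * ((S : ℝ) / n) ^ (k - 1)) := by ring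
          _ ≤ _ := by gcongr
      calc _ ≤ (Real.exp 1 / ((S : ℝ) / n * d)) ^ S *
            Real.exp (c * (m / n) * τ ^ (k - 1)) ^ S := by gcongr
        _ = (Real.exp 1 / ((S : ℝ) / n * d) * Real.exp (c * (m / n) * τ ^ (k - 1))) ^ S := by
            rw [mul_pow]
        _ ≤ (Real.exp 1 / (σ * d) * Real.exp (c * (m / n) * τ ^ (k - 1))) ^ S := by gcongr
        _ ≤ _ := by
            refine pow_le_pow_left₀ (by positivity) (le_add_of_nonneg_right (by positivity)) S
    · have hF : (1 + c * ((S : ℝ) / n) ^ k) ^ m ≤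
          Real.exp (Real.log (1 + c) * (m / n)) ^ S := by
        have hl := log_one_add_mul_pow_le hk hc0 hc hspos hsS
        rw [← Real.exp_log (by positivity : 0 < 1 + c * ((S : ℝ) / n) ^ k), ← Real.exp_nat_mul,
          ← Real.exp_nat_mul]
        refine Real.exp_le_exp.2 ?_
        calc m * Real.log (1 + c * ((S : ℝ) / n) ^ k) ≤ m * (S / n * Real.log (1 + c)) := by gcongr
          _ = _ := by ring
      calc _ ≤ (Real.exp 1 / ((S : ℝ) / n * d)) ^ S *
            Real.exp (Real.log (1 + c) * (m / n)) ^ S := by gcongr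
        _ = (Real.exp 1 / ((S : ℝ) / n * d) * Real.exp (Real.log (1 + c) * (m / n))) ^ S := by
            rw [mul_pow]
        _ ≤ (Real.exp 1 / (τ * d) * Real.exp (Real.log (1 + c) * (m / n))) ^ S := by gcongr
        _ ≤ _ := by
            refine pow_le_pow_left₀ (by positivity) (le_add_of_nonneg_left (by positivity)) S

theorem moment_ratio_le {n d k q m : ℕ} (hk : k ≠ 0) (hd : 2 ≤ d) (hn : k ≤ n) (hq : q < d ^ k)
    {c σ τ : ℝ} (hc0 : 0 ≤ c) (hc : c ≤ (k : ℝ) - 1) (hσ : 0 < σ) (hτ : 0 < τ)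
    (hρ : overlapRatio n d k m c σ τ < 1) :
    secondMoment n d k q m / firstMoment n d k q m ^ 2 ≤
      Real.exp (m * |(q : ℝ) / (((d ^ k : ℕ) : ℝ) - q) - c|) *
        (Real.exp (m * c * σ ^ k) +
          overlapRatio n d k m c σ τ / (1 - overlapRatio n d k m c σ τ)) := by
  have hd1 : (1 : ℝ) ≤ d := by exact_mod_cast (by omega : 1 ≤ d)
  have hρ0 : 0 ≤ overlapRatio n d k m c σ τ := by unfold overlapRatio; positivity
  have hmain := binomial_sum_le (n := n) (d := d) (B := Real.exp (m * c * σ ^ k)) hd1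
    (Real.exp_pos _).le hρ0 hρ (F := fun S => (1 + c * ((S : ℝ) / n) ^ k) ^ m)
    (fun S => by positivity) (fun S hS => overlap_term_le hk (by omega) hc0 hc hσ hτ hS)
  refine (moment_ratio_le_sum hk hd hn hq).trans ?_
  refine le_trans ?_ (mul_le_mul_of_nonneg_left hmain (Real.exp_pos _).le)
  rw [Finset.mul_sum]
  refine Finset.sum_le_sum fun S hS => ?_
  have hS' : S ≤ n := Nat.lt_succ_iff.1 (Finset.mem_range.1 hS)
  have hw : (0 : ℝ) ≤ n.choose S * ((d : ℝ) - 1) ^ (n - S) / (d : ℝ) ^ n := by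
    have : (0 : ℝ) ≤ d - 1 := by linarith
    positivity
  have hx0 : 0 ≤ ((S : ℝ) / n) ^ k := by positivity
  have hx1 : ((S : ℝ) / n) ^ k ≤ 1 :=
    pow_le_one₀ (by positivity) (div_le_one_of_le₀ (by exact_mod_cast hS') (by positivity))
  have hqD : (q : ℝ) < ((d ^ k : ℕ) : ℝ) := by exact_mod_cast hq
  have hc' : 0 ≤ (q : ℝ) / (((d ^ k : ℕ) : ℝ) - q) := div_nonneg (by positivity) (by linarith)
  generalize (q : ℝ) / (((d ^ k : ℕ) : ℝ) - q) = c' at *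
  generalize ((S : ℝ) / n) ^ k = x at *
  -- This trades the exact odds c' for the limiting odds c; it uses x ≤ 1.
  have h1 : 1 + c' * x ≤ Real.exp |c' - c| * (1 + c * x) := by
    have h2 := Real.add_one_le_exp |c' - c|
    have h3 := le_abs_self (c' - c)
    have h4 : 0 ≤ c * x := by positivity
    calc 1 + c' * x ≤ (|c' - c| + 1) * (1 + c * x) := by
          nlinarith [abs_nonneg (c' - c), mul_nonneg (abs_nonneg (c' - c)) h4]
      _ ≤ _ := by gcongr
  calc _ ≤ n.choose S * ((d : ℝ) - 1) ^ (n - S) / (d : ℝ) ^ n *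
        (Real.exp |c' - c| * (1 + c * x)) ^ m := by gcongr
    _ = _ := by
      rw [mul_pow, ← Real.exp_nat_mul]
      ring

/-! ### Asymptotics below the threshold -/

theorem mul_neg_log_lt_of_lt_pCr {α r p : ℝ} (hr : 0 < r) (hp1 : p < 1) (h : p < pCr α r) :
    r * -Real.log (1 - p) < α := by
  unfold pCr at h
  have h1 : Real.exp (-α / r) < 1 - p := by linarith
  rw [← Real.lt_log_iff_exp_lt (by linarith), div_lt_iff₀ hr] at h1
  linarith

theorem mul_neg_log_lt_of_lt_rCr {α r p : ℝ} (hp0 : 0 < p) (hp1 : p < 1) (h : r < rCr α p) :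
    r * -Real.log (1 - p) < α := by
  have hl : Real.log (1 - p) < 0 := Real.log_neg (by linarith) (by linarith)
  rw [rCr, ← neg_div_neg_eq, neg_neg, lt_div_iff₀ (by linarith)] at h
  exact h

theorem below_threshold {k : ℕ} {α r p : ℝ} (hr : 0 < r) (hp0 : 0 < p) (hp1 : p < 1)
    (h : (r < rCr α p ∧ p ≤ ((k : ℝ) - 1) / k) ∨
      (p < pCr α r ∧ pCr α r ≤ ((k : ℝ) - 1) / k)) :
    r * -Real.log (1 - p) < α ∧ p ≤ ((k : ℝ) - 1) / k := by
  rcases h with ⟨h1, h2⟩ | ⟨h1, h2⟩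
  · exact ⟨mul_neg_log_lt_of_lt_rCr hp0 hp1 h1, h2⟩
  · exact ⟨mul_neg_log_lt_of_lt_pCr hr hp1 h1, h1.le.trans h2⟩

theorem tendsto_div_of_abs_sub_lt_one {u v : ℕ → ℝ} (h : ∀ n, |u n - v n| < 1)
    (hv : Tendsto v atTop atTop) : Tendsto (fun n => u n / v n) atTop (𝓝 1) := by
  have h1 : Tendsto (fun n => (u n - v n) / v n) atTop (𝓝 0) := by
    refine squeeze_zero_norm' ?_ (tendsto_inv_atTop_zero.comp hv)
    filter_upwards [hv.eventually_gt_atTop 0] with n hn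
    rw [norm_div, Real.norm_eq_abs, Real.norm_eq_abs, abs_of_pos hn, Function.comp, ← one_div]
    gcongr
    exact (h n).le
  have h2 := h1.add_const 1
  rw [zero_add] at h2
  refine h2.congr' ?_
  filter_upwards [hv.eventually_gt_atTop 0] with n hn
  field_simp
  ring

theorem tendsto_rpow_natCast {γ : ℝ} (hγ : 0 < γ) :
    Tendsto (fun n : ℕ => (n : ℝ) ^ γ) atTop atTop :=
  (tendsto_rpow_atTop hγ).comp tendsto_natCast_atTop_atTop

theorem tendsto_domain {α : ℝ} (hα : 0 < α) {d : ℕ → ℕ} (hd : ∀ n, |(d n : ℝ) - (n : ℝ) ^ α| < 1) :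
    Tendsto (fun n : ℕ => (n : ℝ) ^ α / d n) atTop (𝓝 1) := by
  simpa using (tendsto_div_of_abs_sub_lt_one hd (tendsto_rpow_natCast hα)).inv₀ one_ne_zero

theorem tendsto_domain_atTop {α : ℝ} (hα : 0 < α) {d : ℕ → ℕ}
    (hd : ∀ n, |(d n : ℝ) - (n : ℝ) ^ α| < 1) : Tendsto (fun n => (d n : ℝ)) atTop atTop := by
  refine tendsto_atTop_mono (fun n => ?_)
    (tendsto_atTop_add_const_right atTop (-1) (tendsto_rpow_natCast hα))
  have := (abs_lt.1 (hd n)).1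
  linarith

theorem tendsto_rpow_div_domain {α γ : ℝ} (hα : 0 < α) (hγ : γ < α) {d : ℕ → ℕ}
    (hd : ∀ n, |(d n : ℝ) - (n : ℝ) ^ α| < 1) :
    Tendsto (fun n : ℕ => (n : ℝ) ^ γ / d n) atTop (𝓝 0) := by
  have h1 : Tendsto (fun n : ℕ => (n : ℝ) ^ (-(α - γ))) atTop (𝓝 0) :=
    (tendsto_rpow_neg_atTop (by linarith)).comp tendsto_natCast_atTop_atTop
  have h2 := h1.mul (tendsto_domain hα hd)
  rw [zero_mul] at h2
  refine h2.congr' ?_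
  filter_upwards [eventually_gt_atTop 0] with n hn
  have hn0 : (0 : ℝ) < n := by exact_mod_cast hn
  rw [← mul_div_assoc, ← Real.rpow_add hn0]
  congr 2
  ring

theorem constraints_le {r : ℝ} {m : ℕ → ℕ} (hm : ∀ n, |(m n : ℝ) - r * n * Real.log n| < 1) (n : ℕ) :
    (m n : ℝ) ≤ r * n * Real.log n + 1 := by
  have := (abs_lt.1 (hm n)).2
  linarith

theorem tendsto_constraints_div_rpow {r γ : ℝ} (hγ : 1 < γ) {m : ℕ → ℕ}
    (hm : ∀ n, |(m n : ℝ) - r * n * Real.log n| < 1) :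
    Tendsto (fun n : ℕ => (m n : ℝ) / (n : ℝ) ^ γ) atTop (𝓝 0) := by
  have h1 : Tendsto (fun n : ℕ => Real.log n / (n : ℝ) ^ (γ - 1)) atTop (𝓝 0) :=
    (isLittleO_log_rpow_atTop (by linarith)).tendsto_div_nhds_zero.comp
      tendsto_natCast_atTop_atTop
  have h2 : Tendsto (fun n : ℕ => (n : ℝ) ^ (-γ)) atTop (𝓝 0) :=
    (tendsto_rpow_neg_atTop (by linarith)).comp tendsto_natCast_atTop_atTop
  have h3 := (h1.const_mul r).add h2
  rw [mul_zero, add_zero] at h3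
  refine squeeze_zero' (Eventually.of_forall fun n => by positivity) ?_ h3
  filter_upwards [eventually_gt_atTop 0] with n hn
  have hn0 : (0 : ℝ) < n := by exact_mod_cast hn
  rw [div_le_iff₀ (by positivity)]
  refine (constraints_le hm n).trans (le_of_eq ?_)
  rw [Real.rpow_sub_one hn0.ne', Real.rpow_neg hn0.le]
  field_simp

/-- Rounding `q` shifts the odds by O(1/d^k), and m/d^k → 0 because d^k has order n^(αk) with αk >
1. -/
theorem tendsto_mul_abs_odds_sub {k : ℕ} (hk : k ≠ 0) {α r p : ℝ} (hα : 0 < α) (hαk : 1 < α * k)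
    (hp1 : p < 1) {d m q : ℕ → ℕ} (hd : ∀ n, |(d n : ℝ) - (n : ℝ) ^ α| < 1)
    (hm : ∀ n, |(m n : ℝ) - r * n * Real.log n| < 1)
    (hq : ∀ n, |(q n : ℝ) - p * (d n : ℝ) ^ k| < 1) :
    Tendsto (fun n => (m n : ℝ) *
      |(q n : ℝ) / (((d n ^ k : ℕ) : ℝ) - q n) - p / (1 - p)|) atTop (𝓝 0) := by
  have h1 : Tendsto (fun n => (m n : ℝ) / (d n : ℝ) ^ k) atTop (𝓝 0) := by
    have h := (tendsto_constraints_div_rpow hαk hm).mul ((tendsto_domain hα hd).pow k)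
    rw [zero_mul] at h
    refine h.congr' ?_
    filter_upwards [eventually_gt_atTop 0] with n hn
    have hn0 : (0 : ℝ) < n := by exact_mod_cast hn
    rw [div_pow, ← Real.rpow_mul_natCast hn0.le]
    have : (n : ℝ) ^ (α * k) ≠ 0 := by positivity
    field_simp
  have h2 : Tendsto (fun n => (d n : ℝ) ^ k) atTop atTop :=
    (tendsto_pow_atTop hk).comp (tendsto_domain_atTop hα hd)
  have hp : 0 < 1 - p := by linarith
  have h3 := h1.const_mul (2 / (1 - p) ^ 2)
  rw [mul_zero] at h3
  refine squeeze_zero' (Eventually.of_forall fun n => by positivity) ?_ h3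
  filter_upwards [h2.eventually_gt_atTop (2 / (1 - p))] with n hn
  rw [div_lt_iff₀ hp] at hn
  have hqn := hq n
  push_cast
  generalize (d n : ℝ) ^ k = D at *
  have hD : 0 < D := by
    by_contra h
    nlinarith
  -- Since q < p D + 1, the difference exceeds D (1 - p) - 1, and 1 < D (1 - p)/2.
  have hDq : D * (1 - p) / 2 ≤ D - q n := by
    have := (abs_lt.1 hqn).2
    nlinarith
  have hDq0 : 0 < D - q n := lt_of_lt_of_le (by positivity) hDq
  have heq : (q n : ℝ) / (D - q n) - p / (1 - p) = (q n - p * D) / ((D - q n) * (1 - p)) := by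
    field_simp
    ring
  rw [heq, abs_div, abs_of_pos (mul_pos hDq0 hp)]
  calc (m n : ℝ) * (|(q n : ℝ) - p * D| / ((D - q n) * (1 - p)))
      ≤ m n * (1 / (D * (1 - p) / 2 * (1 - p))) := by gcongr
    _ = _ := by field_simp

theorem tendsto_overlapRatio {k : ℕ} (hk : 2 ≤ k) {α r c β ε : ℝ} (hα : 0 < α) (hc : 0 ≤ c)
    (hβ : β < α) (hε : 0 < ε) (hε' : r * Real.log (1 + c) + ε < α) {d m : ℕ → ℕ}
    (hd : ∀ n, |(d n : ℝ) - (n : ℝ) ^ α| < 1)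
    (hm : ∀ n, |(m n : ℝ) - r * n * Real.log n| < 1) :
    Tendsto (fun n : ℕ => overlapRatio n (d n) k (m n) c ((n : ℝ) ^ (-β)) ((n : ℝ) ^ (-ε)))
      atTop (𝓝 0) := by
  have hL : 0 ≤ Real.log (1 + c) := Real.log_nonneg (by linarith)
  have hk1 : (0 : ℝ) < (k - 1 : ℕ) := by exact_mod_cast (by omega : 0 < k - 1)
  have h1 : Tendsto (fun n : ℕ => Real.exp 1 / ((n : ℝ) ^ (-β) * d n) *
      Real.exp (c * (m n / n) * ((n : ℝ) ^ (-ε)) ^ (k - 1))) atTop (𝓝 0) := by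
    have ha := (tendsto_rpow_div_domain hα hβ hd).const_mul (Real.exp 1)
    -- This exponent turns (m/n) τ^(k-1) into m/n^γ; γ > 1 because k ≥ 2.
    have hb := (tendsto_constraints_div_rpow (γ := 1 + ε * (k - 1 : ℕ))
      (by linarith [mul_pos hε hk1]) hm).const_mul c
    have h := ha.mul ((Real.continuous_exp.tendsto _).comp hb)
    rw [mul_zero, zero_mul] at h
    refine h.congr' ?_
    filter_upwards [eventually_gt_atTop 0] with n hn
    have hn0 : (0 : ℝ) < n := by exact_mod_cast hn
    simp only [Function.comp]
    congr 1
    · rw [Real.rpow_neg hn0.le]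
      field_simp
    · rw [← Real.rpow_mul_natCast hn0.le, neg_mul, Real.rpow_neg hn0.le, Real.rpow_add hn0,
        Real.rpow_one]
      congr 1
      field_simp
  have h2 : Tendsto (fun n : ℕ => Real.exp 1 / ((n : ℝ) ^ (-ε) * d n) *
      Real.exp (Real.log (1 + c) * (m n / n))) atTop (𝓝 0) := by
    have ha := (tendsto_rpow_div_domain hα hε' hd).const_mul
      (Real.exp 1 * Real.exp (Real.log (1 + c)))
    rw [mul_zero] at ha
    refine squeeze_zero' (Eventually.of_forall fun n => by positivity) ?_ ha
    filter_upwards [eventually_gt_atTop 0] with n hn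
    have hn0 : (0 : ℝ) < n := by exact_mod_cast hn
    have hn1 : (1 : ℝ) ≤ n := by exact_mod_cast hn
    have hmn : (m n : ℝ) / n ≤ r * Real.log n + 1 := by
      rw [div_le_iff₀ hn0]
      have := constraints_le hm n
      linarith
    have hexp : Real.exp (Real.log (1 + c) * (m n / n)) ≤
        Real.exp (Real.log (1 + c)) * (n : ℝ) ^ (r * Real.log (1 + c)) := by
      rw [Real.rpow_def_of_pos hn0, ← Real.exp_add]
      refine Real.exp_le_exp.2 ?_
      have := mul_le_mul_of_nonneg_left hmn hL
      linarith
    calc _ ≤ Real.exp 1 / ((n : ℝ) ^ (-ε) * d n) *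
          (Real.exp (Real.log (1 + c)) * (n : ℝ) ^ (r * Real.log (1 + c))) := by gcongr
      _ = _ := by
        rw [Real.rpow_neg hn0.le, Real.rpow_add hn0]
        field_simp
  simpa [overlapRatio] using h1.add h2

theorem eventually_parameters {k : ℕ} (hk : k ≠ 0) {α p : ℝ} (hα : 0 < α) (hp1 : p < 1)
    {d q : ℕ → ℕ} (hd : ∀ n, |(d n : ℝ) - (n : ℝ) ^ α| < 1)
    (hq : ∀ n, |(q n : ℝ) - p * (d n : ℝ) ^ k| < 1) :
    ∀ᶠ n in atTop, 2 ≤ d n ∧ k ≤ n ∧ q n < d n ^ k := by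
  have hp : 0 < 1 - p := by linarith
  have h2 : Tendsto (fun n => (d n : ℝ) ^ k) atTop atTop :=
    (tendsto_pow_atTop hk).comp (tendsto_domain_atTop hα hd)
  filter_upwards [h2.eventually_gt_atTop (1 / (1 - p)), eventually_ge_atTop k,
    (tendsto_domain_atTop hα hd).eventually_ge_atTop 2] with n h3 h4 h5
  refine ⟨by exact_mod_cast h5, h4, ?_⟩
  rw [div_lt_iff₀ hp] at h3
  have := (abs_lt.1 (hq n)).2
  have h6 : (q n : ℝ) < (d n : ℝ) ^ k := by linarith
  exact_mod_cast h6

theorem tendsto_moment_ratio {k : ℕ} (hk : 2 ≤ k) {α r p : ℝ} (hα : 1 / (k : ℝ) < α)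
    (hp0 : 0 < p) (hp1 : p < 1) (hr : r * -Real.log (1 - p) < α) (hpk : p ≤ ((k : ℝ) - 1) / k)
    {d m q : ℕ → ℕ} (hd : ∀ n, |(d n : ℝ) - (n : ℝ) ^ α| < 1)
    (hm : ∀ n, |(m n : ℝ) - r * n * Real.log n| < 1)
    (hq : ∀ n, |(q n : ℝ) - p * (d n : ℝ) ^ k| < 1) :
    Tendsto (fun n => secondMoment n (d n) k (q n) (m n) / firstMoment n (d n) k (q n) (m n) ^ 2)
      atTop (𝓝 1) := by
  have hk0 : k ≠ 0 := by omega
  have hkR : (0 : ℝ) < k := by exact_mod_cast (by omega : 0 < k)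
  have hp : 0 < 1 - p := by linarith
  -- βk > 1 makes m σ^k vanish for σ = n^(-β), while β < α makes σ d tend to infinity.
  obtain ⟨β, hβ1, hβ⟩ := exists_between hα
  have hα0 : 0 < α := lt_trans (by positivity) hα
  rw [div_lt_iff₀ hkR] at hα hβ1
  have hc0 : 0 ≤ p / (1 - p) := by positivity
  have hck : p / (1 - p) ≤ (k : ℝ) - 1 := by
    rw [le_div_iff₀ hkR] at hpk
    rw [div_le_iff₀ hp]
    linarith
  have hlog : Real.log (1 + p / (1 - p)) = -Real.log (1 - p) := by
    rw [← Real.log_inv]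
    congr 1
    field_simp
    ring
  rw [← hlog] at hr
  generalize hc : p / (1 - p) = c at *
  -- Half the gap to the threshold: τ = n^(-ε) spends one half and the other still sends the
  -- large-overlap rate to 0.
  obtain ⟨ε, hε, hε'⟩ : ∃ ε, 0 < ε ∧ r * Real.log (1 + c) + ε < α :=
    ⟨(α - r * Real.log (1 + c)) / 2, by linarith, by linarith⟩
  have hρ := tendsto_overlapRatio hk hα0 hc0 hβ hε hε' hd hm
  have hodds := tendsto_mul_abs_odds_sub hk0 hα0 hα hp1 hd hm hq
  rw [hc] at hodds
  have hη : Tendsto (fun n : ℕ => (m n : ℝ) * c * ((n : ℝ) ^ (-β)) ^ k) atTop (𝓝 0) := by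
    have h := (tendsto_constraints_div_rpow hβ1 hm).const_mul c
    rw [mul_zero] at h
    refine h.congr' ?_
    filter_upwards [eventually_gt_atTop 0] with n hn
    have hn0 : (0 : ℝ) < n := by exact_mod_cast hn
    rw [← Real.rpow_mul_natCast hn0.le, neg_mul, Real.rpow_neg hn0.le]
    field_simp
  have hupper := ((Real.continuous_exp.tendsto _).comp hodds).mul
    (((Real.continuous_exp.tendsto _).comp hη).add (hρ.div (hρ.const_sub 1) (by norm_num)))
  simp only [Real.exp_zero, sub_zero, zero_div, add_zero, one_mul] at hupper
  have hpar := eventually_parameters hk0 hα0 hp1 hd hq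
  refine tendsto_of_tendsto_of_tendsto_of_le_of_le' tendsto_const_nhds hupper ?_ ?_
  · filter_upwards [hpar] with n ⟨_, hn, hqn⟩
    have := firstMoment_pos hk0 hn hqn (m n)
    rw [le_div_iff₀ (by positivity), one_mul]
    exact sq_firstMoment_le_secondMoment hn hqn.le (m n)
  · filter_upwards [hpar, hρ.eventually_lt_const one_pos, eventually_gt_atTop 0]
      with n ⟨hdn, hn, hqn⟩ hρn hn0
    have hn0 : (0 : ℝ) < n := by exact_mod_cast hn0
    exact moment_ratio_le hk0 hdn hn hqn hc0 hck (by positivity) (by positivity) hρn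

end ModelRB

theorem mainTheorem1 (k : ℕ) (hk : 2 ≤ k) :
    -- the exact identity, for all integer parameters
    (∀ n d q m : ℕ, k ≤ n → q < d ^ k →
      0 < ModelRB.firstMoment n d k q m ∧
      (∀ t : ModelRB.Assignment n d,
        0 < ModelRB.pairProb k q m t t ∧
        ModelRB.forcedMean k q m t =
          ∑ u : ModelRB.Assignment n d,
            ModelRB.pairProb k q m t u / ModelRB.pairProb k q m t t ∧
        ModelRB.forcedMean k q m t =
          ModelRB.secondMoment n d k q m / ModelRB.firstMoment n d k q m) ∧
      ModelRB.randomForcedMean n d k q m =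
        ModelRB.secondMoment n d k q m / ModelRB.firstMoment n d k q m) ∧
    -- the asymptotics of model RB below the threshold, for any rounding of the parameters
    (∀ α r p : ℝ, 1 / (k : ℝ) < α → 0 < r → 0 < p → p < 1 →
      ((r < ModelRB.rCr α p ∧ p ≤ ((k : ℝ) - 1) / k) ∨
        (p < ModelRB.pCr α r ∧ ModelRB.pCr α r ≤ ((k : ℝ) - 1) / k)) →
      ∀ d m q : ℕ → ℕ,
        (∀ n, |(d n : ℝ) - (n : ℝ) ^ α| < 1) →
        (∀ n, |(m n : ℝ) - r * n * Real.log n| < 1) →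
        (∀ n, |(q n : ℝ) - p * (d n : ℝ) ^ k| < 1) →
        Tendsto (fun n => ModelRB.secondMoment n (d n) k (q n) (m n) /
          ModelRB.firstMoment n (d n) k (q n) (m n) ^ 2) atTop (𝓝 1) ∧
        (fun n => ModelRB.randomForcedMean n (d n) k (q n) (m n)) ~[atTop]
          (fun n => ModelRB.firstMoment n (d n) k (q n) (m n)) ∧
        ∀ t : (n : ℕ) → ModelRB.Assignment n (d n),
          (fun n => ModelRB.forcedMean k (q n) (m n) (t n)) ~[atTop]
            (fun n => ModelRB.firstMoment n (d n) k (q n) (m n))) := by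
  have hk0 : k ≠ 0 := by omega
  refine ⟨fun n d q m hn hq => ?_, ?_⟩
  · have hs := ModelRB.secondMoment_div_firstMoment hk0 hn hq m
    refine ⟨ModelRB.firstMoment_pos hk0 hn hq m, fun t => ⟨?_, ?_, ?_⟩, ?_⟩
    · rw [ModelRB.pairProb_eq hn hq.le, ModelRB.agreement_self]
      exact pow_pos (ModelRB.satProb_self_pos hn hq) m
    · exact ModelRB.forcedMean_eq_sum hn hq m t
    · rw [hs, ModelRB.forcedMean_eq hn hq]
    · rw [hs, ModelRB.randomForcedMean_eq hk0 hn hq]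
  · intro α r p hα hr hp0 hp1 h d m q hd hm hq
    obtain ⟨hrα, hpk⟩ := ModelRB.below_threshold hr hp0 hp1 h
    have hα0 : 0 < α := lt_trans (by positivity) hα
    have hratio := ModelRB.tendsto_moment_ratio hk hα hp0 hp1 hrα hpk hd hm hq
    have hpar := ModelRB.eventually_parameters hk0 hα0 hp1 hd hq
    refine ⟨hratio, ?_, fun t => ?_⟩
    · refine Asymptotics.isEquivalent_of_tendsto_one (hratio.congr' ?_)
      filter_upwards [hpar] with n ⟨_, hn, hqn⟩
      rw [Pi.div_apply, ModelRB.randomForcedMean_eq hk0 hn hqn,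
        ← ModelRB.secondMoment_div_firstMoment hk0 hn hqn, div_div, sq]
    · refine Asymptotics.isEquivalent_of_tendsto_one (hratio.congr' ?_)
      filter_upwards [hpar] with n ⟨_, hn, hqn⟩
      rw [Pi.div_apply, ModelRB.forcedMean_eq hn hqn,
        ← ModelRB.secondMoment_div_firstMoment hk0 hn hqn, div_div, sq]
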